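/- For $A\subseteq\mathbb{R}^d$ and $0<\rho<r$, let $N_A(r,\rho)$ be the maximum over $x\in A$ of the least number of open balls of radius $\rho$ that cover $\{y\in A:\|x-y\|<r\}$. The Assouad dimension $\dim_A A$ is the infimum of all $s\ge 0$ for which there is a constant $K$ with $N_A(r,\rho)\le K(r/\rho)^s$ for all $0<\rho<r\le 1$; $\dim_H$ denotes Hausdorff dimension. A non-empty compact set $F$ is an attractor of finitely many maps $S_1,\dots,S_n:\mathbb{R}^d\to\mathbb{R}^d$ if $F=\bigcup_i S_i(F)$; it is self-similar if the $S_i$ can be taken to be contracting similarities. Let $t=4\sum_{k=0}^{\infty}5^{-2^k}$ and consider the four maps of $\mathbb{R}^2$ $$S_1(x)=\tfrac{x}{5},\quad S_2(x)=\tfrac{x}{5}+\left(\tfrac{t}{5},0\right),\quad S_3(x)=\tfrac{x}{5}+\left(\tfrac45,0\right),\quad S_4(x)=\tfrac{x}{5}+\left(0,\tfrac45\right).$$ They have a unique attractor $F$, which is not contained in any line, and $$\dim_H F\le\frac{\log 4}{\log 5}<1\le\dim_A F\le 1+\frac{\log 2}{\log 5}<2 .$$ Consequently the dichotomy "a self-similar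 set in $\mathbb{R}^d$ that is not contained in any $(d-1)$-dimensional hyperplane has Assouad dimension equal either to its Hausdorff dimension or to $d$" is false for $d=2$. -/

import Mathlib

open scoped NNReal ENNReal

noncomputable section

/-- The smallest number of open balls of radius `ρ` required to cover `E`
(`⊤` if no finite number suffices). -/
def coverNumber {X : Type*} [PseudoMetricSpace X] (E : Set X) (ρ : ℝ) : ℕ∞ :=
  ⨅ (C : Finset X) (_ : E ⊆ ⋃ c ∈ C, Metric.ball c ρ), (C.card : ℕ∞)

/-- The largest covering number, at scale `ρ`, of a piece `A ∩ B_r(x)` with `x ∈ A`. -/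
def localCoverNumber {X : Type*} [PseudoMetricSpace X] (A : Set X) (r ρ : ℝ) : ℕ∞ :=
  ⨆ x ∈ A, coverNumber (A ∩ Metric.ball x r) ρ

/-- The Assouad dimension: the infimum of all `s ≥ 0` for which there is a constant `K` with
`localCoverNumber A r ρ ≤ K (r / ρ) ^ s` whenever `0 < ρ < r ≤ 1`. -/
def assouadDim {X : Type*} [PseudoMetricSpace X] (A : Set X) : ℝ≥0∞ :=
  ⨅ (s : ℝ≥0) (_ : ∃ K : ℝ, ∀ r ρ : ℝ, 0 < ρ → ρ < r → r ≤ 1 →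
    (localCoverNumber A r ρ : ℝ≥0∞) ≤ ENNReal.ofReal (K * (r / ρ) ^ (s : ℝ))), (s : ℝ≥0∞)

/-- A contracting similarity. -/
def IsContractingSimilarity {X : Type*} [PseudoMetricSpace X] (S : X → X) : Prop :=
  ∃ c : ℝ, 0 < c ∧ c < 1 ∧ ∀ x y, dist (S x) (S y) = c * dist x y

/-- `F` is an attractor of the family `S`: a non-empty compact set with `F = ⋃ i, S i (F)`. -/
def IsAttractor {X : Type*} [TopologicalSpace X] {ι : Type*} (S : ι → X → X) (F : Set X) : Prop :=
  F.Nonempty ∧ IsCompact F ∧ F = ⋃ i, S i '' F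

/-- A self-similar set: the attractor of a finite family of contracting similarities. -/
def IsSelfSimilarSet {X : Type*} [PseudoMetricSpace X] (F : Set X) : Prop :=
  ∃ (n : ℕ) (S : Fin n → X → X), (∀ i, IsContractingSimilarity (S i)) ∧ IsAttractor S F

/-- `F ⊆ ℝ^d` lies in some `(d - 1)`-dimensional affine subspace (for `d = 2`: in a line). -/
def InHyperplane {d : ℕ} (F : Set (EuclideanSpace ℝ (Fin d))) : Prop :=
  ∃ H : AffineSubspace ℝ (EuclideanSpace ℝ (Fin d)),
    Module.finrank ℝ H.direction + 1 = d ∧ F ⊆ (H : Set (EuclideanSpace ℝ (Fin d)))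

/-- The equality/maximal dichotomy in `ℝ^d`: every self-similar set that lies in no hyperplane has
Assouad dimension equal to its Hausdorff dimension or to the dimension `d` of the space. -/
def EqualityMaximalDichotomy (d : ℕ) : Prop :=
  ∀ F : Set (EuclideanSpace ℝ (Fin d)), IsSelfSimilarSet F → ¬ InHyperplane F →
    assouadDim F = dimH F ∨ assouadDim F = (d : ℝ≥0∞)

/-- The translation parameter `t = 4 ∑_{k ≥ 0} 5 ^ (-2 ^ k) = 0.96641024…`. -/
def specialT : ℝ := 4 * ∑' k : ℕ, ((5 : ℝ) ^ (2 ^ k))⁻¹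

theorem summable_specialT : Summable fun k : ℕ => ((5 : ℝ) ^ (2 ^ k))⁻¹ := by
  have h : Summable fun k : ℕ => ((5 : ℝ)⁻¹) ^ k :=
    summable_geometric_of_lt_one (by norm_num) (by norm_num)
  refine Summable.of_nonneg_of_le (fun k => by positivity) (fun k => ?_) h
  rw [← inv_pow]
  exact pow_le_pow_of_le_one (by norm_num) (by norm_num) Nat.lt_two_pow_self.le

/-- The four maps `x/5`, `x/5 + (t/5, 0)`, `x/5 + (4/5, 0)`, `x/5 + (0, 4/5)` of the plane. -/
def planarIFS (t : ℝ) : Fin 4 → EuclideanSpace ℝ (Fin 2) → EuclideanSpace ℝ (Fin 2) :=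
  ![fun x => (1 / 5 : ℝ) • x,
    fun x => (1 / 5 : ℝ) • x + !₂[t / 5, 0],
    fun x => (1 / 5 : ℝ) • x + !₂[4 / 5, 0],
    fun x => (1 / 5 : ℝ) • x + !₂[0, 4 / 5]]

end

/-! The base-5 expansion of `t` has long gaps. Multiplied by 5^(2^m), its partial sum up to k = m
becomes a sum of digits 0 and 4, while 5^(2^m) t is the single digit `t` in place 2^m. Both are sums
∑ 5^i a_i with a_i ∈ {0, t, 4}, and they differ by the scaled tail, which lies between 4·5^(-2^m)
and 5·5^(-2^m) (`exists_close_digitSums`).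

Shifted to free higher places, such a pair gives a choice between two blocks whose values differ by
about 5^(-e), for any prescribed e. Stacking many independent choices makes the digit sums dense at
scale 5·5^(-e) in an interval of length at least 1/2 (`exists_dense_digitSums`). Divided by 5^n they
are points of F on the horizontal axis, so at scale 5^(-n) some piece of F looks like a segment up
to relative error 5·5^(-e). This forces dim_A F ≥ 1 (`exists_large_localCoverNumber`).

For the upper bound, second coordinates of F lie in the base-5 Cantor set with digits 0 and 4, which
is well separated. Hence F lies in a product of a line with a set of Assouad dimension at most log 2
/ log 5 (`exists_local_cantor_cover`). The four maps of ratio 1/5 give the Hausdorff bound by the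
natural covers. -/

/-! ### Attractors: existence and uniqueness -/

theorem attractor_map_mem {X ι : Type*} [TopologicalSpace X] {S : ι → X → X} {F : Set X}
    (h : IsAttractor S F) (i : ι) {x : X} (hx : x ∈ F) : S i x ∈ F := by
  rw [h.2.2]
  exact Set.mem_iUnion.2 ⟨i, x, hx, rfl⟩

theorem attractor_exists_preimage {X ι : Type*} [TopologicalSpace X] {S : ι → X → X} {F : Set X}
    (h : IsAttractor S F) {x : X} (hx : x ∈ F) : ∃ i, ∃ y ∈ F, S i y = x := by
  rw [h.2.2] at hx
  simpa using hx

/-- One attractor is contained in any other attractor of the same uniformly contracting family. -/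
theorem attractor_subset {X ι : Type*} [PseudoMetricSpace X] [T2Space X] {S : ι → X → X} {c : ℝ}
    (hc0 : 0 ≤ c) (hc1 : c < 1)
    (hS : ∀ i x y, dist (S i x) (S i y) ≤ c * dist x y) {F G : Set X}
    (hF : IsAttractor S F) (hG : IsAttractor S G) : F ⊆ G := by
  obtain ⟨q₀, hq₀⟩ := hG.1
  obtain ⟨D, hD⟩ := hF.2.1.isBounded.subset_closedBall q₀
  have key : ∀ n : ℕ, ∀ p ∈ F, ∃ q ∈ G, dist p q ≤ c ^ n * D := by
    intro n
    induction n with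
    | zero => exact fun p hp => ⟨q₀, hq₀, by simpa using hD hp⟩
    | succ n ih =>
      intro p hp
      obtain ⟨i, p', hp', rfl⟩ := attractor_exists_preimage hF hp
      obtain ⟨q, hq, hpq⟩ := ih p' hp'
      refine ⟨S i q, attractor_map_mem hG i hq, (hS i p' q).trans ?_⟩
      calc c * dist p' q ≤ c * (c ^ n * D) := by gcongr
        _ = c ^ (n + 1) * D := by ring
  intro p hp
  rw [← hG.2.1.isClosed.closure_eq, Metric.mem_closure_iff]
  intro ε hε
  have hlim : Filter.Tendsto (fun n : ℕ => c ^ n * D) Filter.atTop (nhds 0) := by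
    simpa using (tendsto_pow_atTop_nhds_zero_of_lt_one hc0 hc1).mul_const D
  obtain ⟨n, hn⟩ := (hlim.eventually (gt_mem_nhds hε)).exists
  obtain ⟨q, hq, hpq⟩ := key n p hp
  exact ⟨q, hq, hpq.trans_lt hn⟩

/-- A finite family of homotheties with a common ratio has an attractor. -/
theorem exists_attractor_smul_add {E ι : Type*} [NormedAddCommGroup E] [NormedSpace ℝ E]
    [CompleteSpace E] [Finite ι] [Nonempty ι] {c : ℝ} (hc0 : 0 ≤ c) (hc1 : c < 1) (b : ι → E) :
    ∃ F : Set E, IsAttractor (fun i x => c • x + b i) F := by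
  -- With the discrete topology on the finite `ι`, the space of words `ℕ → ι` is compact; the
  -- attractor is its image under w ↦ ∑ c^n b(w n).
  let _ : TopologicalSpace ι := ⊥
  have _ : DiscreteTopology ι := ⟨rfl⟩
  obtain ⟨B, hB⟩ := (Set.finite_range fun i => ‖b i‖).bddAbove
  have hB' : ∀ i, ‖b i‖ ≤ B := fun i => hB ⟨i, rfl⟩
  let f : (ℕ → ι) → ℕ → E := fun w n => c ^ n • b (w n)
  have hbound : ∀ n w, ‖f w n‖ ≤ c ^ n * B := fun n w => by
    rw [norm_smul, norm_pow, Real.norm_of_nonneg hc0]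
    exact mul_le_mul_of_nonneg_left (hB' _) (by positivity)
  have hsum : Summable fun n : ℕ => c ^ n * B := (summable_geometric_of_lt_one hc0 hc1).mul_right B
  have hf : ∀ w, Summable (f w) := fun w => Summable.of_norm_bounded hsum fun n => hbound n w
  have hcont : Continuous fun w => ∑' n, f w n := by
    refine continuous_tsum (fun n => ?_) hsum hbound
    exact ((continuous_of_discreteTopology (f := b)).comp (continuous_apply n)).const_smul _
  have hrec : ∀ w, ∑' n, f w n = c • (∑' n, f (fun k => w (k + 1)) n) + b (w 0) := fun w => by
    rw [(hf w).tsum_eq_zero_add, ← (hf _).tsum_const_smul, add_comm]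
    simp [f, pow_succ', mul_smul]
  refine ⟨Set.range fun w => ∑' n, f w n, Set.range_nonempty _, isCompact_range hcont, ?_⟩
  ext x
  simp only [Set.mem_range, Set.mem_iUnion, Set.mem_image, exists_exists_eq_and]
  constructor
  · rintro ⟨w, rfl⟩
    exact ⟨w 0, _, (hrec w).symm⟩
  · rintro ⟨i, w, rfl⟩
    exact ⟨fun k => Nat.casesOn k i w, hrec _⟩

/-! ### The planar system and its attractor -/

noncomputable section

/-- The translation vectors of `planarIFS`. -/
def planarShift (t : ℝ) : Fin 4 → EuclideanSpace ℝ (Fin 2) :=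
  ![0, !₂[t / 5, 0], !₂[4 / 5, 0], !₂[0, 4 / 5]]

end

theorem planarIFS_eq (t : ℝ) : planarIFS t = fun i x => (1 / 5 : ℝ) • x + planarShift t i := by
  funext i x
  fin_cases i <;> simp [planarIFS, planarShift]

theorem dist_planarIFS (t : ℝ) (i : Fin 4) (x y : EuclideanSpace ℝ (Fin 2)) :
    dist (planarIFS t i x) (planarIFS t i y) = 1 / 5 * dist x y := by
  rw [planarIFS_eq]
  simp only [dist_add_right]
  rw [dist_smul₀, Real.norm_of_nonneg (by norm_num)]

theorem existsUnique_attractor_planarIFS (t : ℝ) :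
    ∃! F : Set (EuclideanSpace ℝ (Fin 2)), IsAttractor (planarIFS t) F := by
  obtain ⟨F, hF⟩ := exists_attractor_smul_add (c := 1 / 5) (by norm_num) (by norm_num)
    (planarShift t)
  rw [← planarIFS_eq] at hF
  have hS : ∀ i x y, dist (planarIFS t i x) (planarIFS t i y) ≤ 1 / 5 * dist x y :=
    fun i x y => (dist_planarIFS t i x y).le
  exact ⟨F, hF, fun G hG => (attractor_subset (by norm_num) (by norm_num) hS hG hF).antisymm
    (attractor_subset (by norm_num) (by norm_num) hS hF hG)⟩

theorem isSelfSimilarSet_attractor_planarIFS {t : ℝ} {F : Set (EuclideanSpace ℝ (Fin 2))}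
    (hF : IsAttractor (planarIFS t) F) : IsSelfSimilarSet F :=
  ⟨4, planarIFS t, fun i => ⟨1 / 5, by norm_num, by norm_num, dist_planarIFS t i⟩, hF⟩

theorem planarIFS_apply_one (t : ℝ) (i : Fin 4) (x : EuclideanSpace ℝ (Fin 2)) :
    planarIFS t i x 1 = x 1 / 5 + (![0, 0, 0, 4 / 5] : Fin 4 → ℝ) i := by
  fin_cases i <;> simp [planarIFS] <;> ring

/-- A real function on a compact set that is controlled by `1/5` of its values plus a number in
`[0, 4/5]` takes values in `[0, 1]`. -/
theorem mem_Icc_of_compact_of_step {X : Type*} [TopologicalSpace X] {F : Set X} (hF : IsCompact F)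
    {f : X → ℝ} (hf : Continuous f)
    (h : ∀ p ∈ F, ∃ q ∈ F, ∃ a ∈ Set.Icc (0 : ℝ) (4 / 5), f p = f q / 5 + a) {p : X} (hp : p ∈ F) :
    f p ∈ Set.Icc (0 : ℝ) 1 := by
  obtain ⟨u, hu, hu'⟩ := hF.exists_isMaxOn ⟨p, hp⟩ hf.continuousOn
  obtain ⟨l, hl, hl'⟩ := hF.exists_isMinOn ⟨p, hp⟩ hf.continuousOn
  obtain ⟨q, hq, a, ha, e⟩ := h u hu
  obtain ⟨q', hq', a', ha', e'⟩ := h l hl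
  have h1 := isMaxOn_iff.1 hu' q hq
  have h2 := isMinOn_iff.1 hl' q' hq'
  have h3 := isMaxOn_iff.1 hu' p hp
  have h4 := isMinOn_iff.1 hl' p hp
  -- The maximum M satisfies M ≤ M/5 + 4/5 and the minimum l satisfies l ≥ l/5.
  constructor <;> linarith [ha.1, ha.2, ha'.1, ha'.2]

theorem attractor_coord_one_step {t : ℝ}
    {F : Set (EuclideanSpace ℝ (Fin 2))} (hF : IsAttractor (planarIFS t) F)
    {p : EuclideanSpace ℝ (Fin 2)} (hp : p ∈ F) :
    ∃ q ∈ F, ∃ a : ℝ, (a = 0 ∨ a = 4 / 5) ∧ p 1 = q 1 / 5 + a := by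
  obtain ⟨i, q, hq, rfl⟩ := attractor_exists_preimage hF hp
  refine ⟨q, hq, _, ?_, planarIFS_apply_one t i q⟩
  fin_cases i <;> simp

theorem attractor_coord_one_mem_Icc {t : ℝ}
    {F : Set (EuclideanSpace ℝ (Fin 2))} (hF : IsAttractor (planarIFS t) F)
    {p : EuclideanSpace ℝ (Fin 2)} (hp : p ∈ F) : p 1 ∈ Set.Icc (0 : ℝ) 1 := by
  refine mem_Icc_of_compact_of_step hF.2.1 (f := fun p => p 1) (by fun_prop) (fun p hp => ?_) hp
  obtain ⟨q, hq, a, ha, e⟩ := attractor_coord_one_step hF hp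
  exact ⟨q, hq, a, by rcases ha with rfl | rfl <;> norm_num, e⟩

/-- The attractor contains every point fixed by one of the maps. -/
theorem fixedPoint_mem_attractor {t : ℝ} {F : Set (EuclideanSpace ℝ (Fin 2))}
    (hF : IsAttractor (planarIFS t) F) {i : Fin 4} {p : EuclideanSpace ℝ (Fin 2)}
    (hp : planarIFS t i p = p) : p ∈ F := by
  obtain ⟨q, hq⟩ := hF.1
  have hmem : ∀ n : ℕ, (planarIFS t i)^[n] q ∈ F := fun n => by
    induction n with
    | zero => exact hq
    | succ n ih =>
      rw [Function.iterate_succ_apply']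
      exact attractor_map_mem hF i ih
  have hdist : ∀ n : ℕ, dist ((planarIFS t i)^[n] q) p = (1 / 5) ^ n * dist q p := fun n => by
    induction n with
    | zero => simp
    | succ n ih =>
      rw [Function.iterate_succ_apply']
      nth_rewrite 1 [← hp]
      rw [dist_planarIFS, ih]
      ring
  refine hF.2.1.isClosed.mem_of_tendsto (b := Filter.atTop)
    (f := fun n : ℕ => (planarIFS t i)^[n] q) ?_ (Filter.Eventually.of_forall hmem)
  rw [tendsto_iff_dist_tendsto_zero]
  simp_rw [hdist]
  simpa using (tendsto_pow_atTop_nhds_zero_of_lt_one (r := (1 / 5 : ℝ)) (by norm_num)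
    (by norm_num)).mul_const (dist q p)

theorem zero_mem_attractor {t : ℝ} {F : Set (EuclideanSpace ℝ (Fin 2))}
    (hF : IsAttractor (planarIFS t) F) : (0 : EuclideanSpace ℝ (Fin 2)) ∈ F :=
  fixedPoint_mem_attractor hF (i := 0) (by simp [planarIFS])

theorem not_inHyperplane_attractor {t : ℝ} {F : Set (EuclideanSpace ℝ (Fin 2))}
    (hF : IsAttractor (planarIFS t) F) : ¬ InHyperplane F := by
  rintro ⟨H, hH, hFH⟩
  have h0 := zero_mem_attractor hF
  have h1 : !₂[(1 : ℝ), 0] ∈ F := fixedPoint_mem_attractor hF (i := 2) (by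
    ext j
    fin_cases j <;> simp [planarIFS]
    norm_num)
  have h2 : !₂[(0 : ℝ), 1] ∈ F := fixedPoint_mem_attractor hF (i := 3) (by
    ext j
    fin_cases j <;> simp [planarIFS]
    norm_num)
  have d1 := AffineSubspace.vsub_mem_direction (hFH h1) (hFH h0)
  have d2 := AffineSubspace.vsub_mem_direction (hFH h2) (hFH h0)
  simp only [vsub_eq_sub, sub_zero] at d1 d2
  have htop : H.direction = ⊤ := by
    rw [eq_top_iff]
    intro x _
    have hx : x = x 0 • !₂[(1 : ℝ), 0] + x 1 • !₂[(0 : ℝ), 1] := by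
      ext j
      fin_cases j <;> simp
    rw [hx]
    exact H.direction.add_mem (H.direction.smul_mem _ d1) (H.direction.smul_mem _ d2)
  rw [htop] at hH
  simp at hH

/-! ### Close pairs of digit sums and density in an interval -/

/-- The leading term of the scaled tail is 1, and its term of index k is at most 5^(-k). -/
theorem tail_specialT_bounds (m : ℕ) :
    1 ≤ 5 ^ (2 ^ (m + 1)) * ∑' k : ℕ, ((5 : ℝ) ^ (2 ^ (k + (m + 1))))⁻¹ ∧
      5 ^ (2 ^ (m + 1)) * ∑' k : ℕ, ((5 : ℝ) ^ (2 ^ (k + (m + 1))))⁻¹ ≤ 5 / 4 := by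
  have hs : Summable fun k : ℕ => 5 ^ (2 ^ (m + 1)) * ((5 : ℝ) ^ (2 ^ (k + (m + 1))))⁻¹ :=
    ((summable_nat_add_iff (m + 1)).2 summable_specialT).mul_left _
  rw [← tsum_mul_left]
  constructor
  · refine le_trans (le_of_eq ?_) (hs.le_tsum 0 fun k _ => by positivity)
    rw [zero_add, mul_inv_cancel₀ (by positivity)]
  · have hg := hasSum_geometric_of_lt_one (r := (1 / 5 : ℝ)) (by norm_num) (by norm_num)
    have h54 : (5 / 4 : ℝ) = (1 - 1 / 5)⁻¹ := by norm_num
    rw [h54]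
    refine hasSum_le (fun k => ?_) hs.hasSum hg
    have hk : 2 ^ (m + 1) + k ≤ 2 ^ (k + (m + 1)) := by
      have h1 : k + 1 ≤ 2 ^ k := Nat.lt_two_pow_self
      have h2 : 1 ≤ 2 ^ (m + 1) := Nat.one_le_two_pow
      rw [pow_add 2 k]
      nlinarith
    rw [mul_inv_le_iff₀ (by positivity), one_div, inv_pow, inv_mul_eq_div,
      le_div_iff₀ (by positivity), ← pow_add]
    exact pow_le_pow_right₀ (by norm_num) hk

theorem specialT_eq_sum_add_tail (m : ℕ) :
    specialT = 4 * (∑ k ∈ Finset.range (m + 1), ((5 : ℝ) ^ (2 ^ k))⁻¹ +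
      ∑' k : ℕ, ((5 : ℝ) ^ (2 ^ (k + (m + 1))))⁻¹) := by
  rw [specialT, summable_specialT.sum_add_tsum_nat_add (m + 1)]

/-- The numbers `∑ i < n, 5 ^ i * a i` with digits `a i ∈ {0, t, 4}`. -/
def digitSums (t : ℝ) : ℕ → Set ℝ
  | 0 => {0}
  | n + 1 => {y | ∃ x ∈ digitSums t n, ∃ a : ℝ, (a = 0 ∨ a = t ∨ a = 4) ∧ y = x + 5 ^ n * a}

theorem digitSums_mono {t : ℝ} {n m : ℕ} (h : n ≤ m) : digitSums t n ⊆ digitSums t m := by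
  induction m, h using Nat.le_induction with
  | base => exact subset_rfl
  | succ m _ ih => exact fun x hx => ⟨x, ih hx, 0, Or.inl rfl, by simp⟩

theorem zero_mem_digitSums (t : ℝ) (n : ℕ) : (0 : ℝ) ∈ digitSums t n :=
  digitSums_mono (Nat.zero_le n) rfl

/-- Concatenation of digit strings, with `z` in the higher places. -/
theorem add_mul_mem_digitSums {t x z : ℝ} {n k : ℕ} (hx : x ∈ digitSums t n)
    (hz : z ∈ digitSums t k) : x + 5 ^ n * z ∈ digitSums t (n + k) := by
  induction k generalizing z with
  | zero =>
    obtain rfl : z = 0 := hz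
    simpa using hx
  | succ k ih =>
    obtain ⟨z', hz', a, ha, rfl⟩ := hz
    exact ⟨_, ih hz', a, ha, by rw [Nat.add_eq, pow_add]; ring⟩

theorem pow_mul_mem_digitSums (t : ℝ) (n : ℕ) : 5 ^ n * t ∈ digitSums t (n + 1) :=
  ⟨0, zero_mem_digitSums t n, t, by simp, by simp⟩

theorem partialSum_mem_digitSums (t : ℝ) (m : ℕ) :
    4 * (5 ^ (2 ^ m) * ∑ k ∈ Finset.range (m + 1), ((5 : ℝ) ^ (2 ^ k))⁻¹) ∈
      digitSums t (2 ^ m) := by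
  induction m with
  | zero => exact ⟨0, rfl, 4, by simp, by norm_num⟩
  | succ m ih =>
    have h4 : (4 : ℝ) ∈ digitSums t (2 ^ m) :=
      digitSums_mono Nat.one_le_two_pow ⟨0, rfl, 4, by simp, by norm_num⟩
    have h := add_mul_mem_digitSums h4 ih
    rw [← two_mul, ← pow_succ'] at h
    -- Passing from m to m + 1 multiplies the old sum by 5^(2^m), and the new summand contributes
    -- exactly the digit 4 in place 0.
    convert h using 1
    rw [Finset.sum_range_succ _ (m + 1), pow_succ 2 m, pow_mul]
    field_simp
    ring

/-- Two digit sums of the same length whose difference, suitably rescaled, is close to `4`. -/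
theorem exists_close_digitSums (m : ℕ) :
    ∃ u ∈ digitSums specialT (2 ^ m + 1), ∃ v ∈ digitSums specialT (2 ^ m + 1),
      4 ≤ 5 ^ (2 ^ m) * (u - v) ∧ 5 ^ (2 ^ m) * (u - v) ≤ 5 := by
  refine ⟨_, pow_mul_mem_digitSums specialT (2 ^ m), _,
    digitSums_mono (Nat.le_succ _) (partialSum_mem_digitSums specialT m), ?_⟩
  obtain ⟨h1, h2⟩ := tail_specialT_bounds m
  have e : (5 : ℝ) ^ (2 ^ m) * (5 ^ (2 ^ m) * specialT -
      4 * (5 ^ (2 ^ m) * ∑ k ∈ Finset.range (m + 1), ((5 : ℝ) ^ (2 ^ k))⁻¹)) =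
      4 * (5 ^ (2 ^ (m + 1)) * ∑' k : ℕ, ((5 : ℝ) ^ (2 ^ (k + (m + 1))))⁻¹) := by
    rw [specialT_eq_sum_add_tail m, pow_succ 2 m, pow_mul]
    ring
  rw [e]
  constructor <;> linarith

/-- Each new close pair lengthens the interval by at least 4·5^(-e) without increasing the error,
because the pair occupies places not yet used. -/
theorem exists_dense_digitSums (e : ℕ) (j : ℕ) :
    ∃ n : ℕ, ∃ b : ℝ, ∀ y ∈ Set.Icc (0 : ℝ) (5 * (1 / 5) ^ e + j * (4 * (1 / 5) ^ e)),
      ∃ x ∈ digitSums specialT n, |x - (b + y)| ≤ 5 * (1 / 5) ^ e := by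
  induction j with
  | zero =>
    refine ⟨0, 0, fun y hy => ⟨0, rfl, ?_⟩⟩
    simp only [CharP.cast_eq_zero, zero_mul, add_zero] at hy
    rw [abs_le]
    constructor <;> linarith [hy.1, hy.2]
  | succ j ih =>
    obtain ⟨n, b, h⟩ := ih
    -- Shifting the pair by i = 2^m - e places turns its difference into one between 4·5^(-e) and
    -- 5·5^(-e); `m` is large enough that i ≥ n.
    obtain ⟨m, hm⟩ : ∃ m, n + e ≤ 2 ^ m := ⟨n + e, Nat.lt_two_pow_self.le⟩
    obtain ⟨i, hi⟩ : ∃ i, 2 ^ m = i + e := ⟨2 ^ m - e, by omega⟩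
    obtain ⟨u, hu, v, hv, h4, h5⟩ := exists_close_digitSums m
    have hpow : (5 : ℝ) ^ i * (u - v) = (1 / 5) ^ e * (5 ^ (2 ^ m) * (u - v)) := by
      rw [hi, pow_add, one_div, inv_pow]
      field_simp
    have hpos : (0 : ℝ) < (1 / 5) ^ e := by positivity
    have hd4 : 4 * (1 / 5) ^ e ≤ (5 : ℝ) ^ i * (u - v) := by rw [hpow]; nlinarith
    have hd5 : (5 : ℝ) ^ i * (u - v) ≤ 5 * (1 / 5) ^ e := by rw [hpow]; nlinarith
    have hni : n ≤ i := by omega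
    have hj : (0 : ℝ) ≤ j * (4 * (1 / 5) ^ e) := by positivity
    refine ⟨i + (2 ^ m + 1), b + 5 ^ i * v, fun y hy => ?_⟩
    have hy2 := hy.2
    push_cast at hy2
    -- Points of the old interval use the block `v`. Beyond it, the block `u` shifts back by at most
    -- 5·5^(-e), hence not below 0, and by at least 4·5^(-e), hence into the old interval.
    by_cases hyj : y ≤ 5 * (1 / 5) ^ e + j * (4 * (1 / 5) ^ e)
    · obtain ⟨x, hx, hxy⟩ := h y ⟨hy.1, hyj⟩
      refine ⟨_, add_mul_mem_digitSums (digitSums_mono hni hx) hv, ?_⟩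
      convert hxy using 2
      ring
    · obtain ⟨x, hx, hxy⟩ := h (y - 5 ^ i * (u - v)) ⟨by linarith, by linarith⟩
      refine ⟨_, add_mul_mem_digitSums (digitSums_mono hni hx) hu, ?_⟩
      convert hxy using 2
      ring

/-- A new top digit `a` amounts to applying the map with translation (a/5, 0). -/
theorem digitSums_mem_attractor {t : ℝ} {F : Set (EuclideanSpace ℝ (Fin 2))}
    (hF : IsAttractor (planarIFS t) F) {n : ℕ} {x : ℝ} (hx : x ∈ digitSums t n) :
    !₂[x * (1 / 5) ^ n, 0] ∈ F := by
  induction n generalizing x with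
  | zero =>
    obtain rfl : x = 0 := hx
    have e : !₂[(0 : ℝ) * (1 / 5) ^ 0, 0] = 0 := by
      ext j
      fin_cases j <;> simp
    exact e ▸ zero_mem_attractor hF
  | succ n ih =>
    obtain ⟨x, hx, a, ha, rfl⟩ := hx
    have h5 : (5 : ℝ) ^ n * (1 / 5) ^ n = 1 := by rw [← mul_pow]; norm_num
    have e : (x + 5 ^ n * a) * (1 / 5) ^ (n + 1) = x * (1 / 5) ^ n / 5 + a / 5 := by
      rw [pow_succ]
      linear_combination a / 5 * h5
    rw [e]
    rcases ha with rfl | rfl | rfl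
    · convert attractor_map_mem hF 0 (ih hx) using 1
      ext j
      fin_cases j <;> simp [planarIFS]
      ring
    · convert attractor_map_mem hF 1 (ih hx) using 1
      ext j
      fin_cases j <;> simp [planarIFS]
      ring
    · convert attractor_map_mem hF 2 (ih hx) using 1
      ext j
      fin_cases j <;> simp [planarIFS]
      ring

/-! ### Lower bound for the Assouad dimension -/

theorem exists_finset_of_coverNumber_le {X : Type*} [PseudoMetricSpace X] {E : Set X} {ρ : ℝ}
    {N : ℕ} (h : coverNumber E ρ ≤ N) :
    ∃ C : Finset X, E ⊆ ⋃ c ∈ C, Metric.ball c ρ ∧ C.card ≤ N := by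
  have h' : coverNumber E ρ < (N + 1 : ℕ) := h.trans_lt (by exact_mod_cast Nat.lt_succ_self N)
  simp only [coverNumber, iInf_lt_iff] at h'
  obtain ⟨C, hC, hCN⟩ := h'
  exact ⟨C, hC, Nat.lt_succ_iff.1 (by exact_mod_cast hCN)⟩

/-- An interval of length `ℓ` covered by `N` closed intervals of length `2 δ` has `ℓ ≤ 2 N δ`. -/
theorem length_le_card_mul_of_cover {ι : Type*} {C : Finset ι} {f : ι → ℝ} {b ℓ δ : ℝ}
    (hδ : 0 ≤ δ) (h : ∀ y ∈ Set.Icc (0 : ℝ) ℓ, ∃ c ∈ C, |b + y - f c| ≤ δ) :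
    ℓ ≤ C.card * (2 * δ) := by
  have hsub : Set.Icc b (b + ℓ) ⊆ ⋃ c ∈ C, Metric.closedBall (f c) δ := fun z hz => by
    obtain ⟨c, hc, hzc⟩ := h (z - b) ⟨by linarith [hz.1], by linarith [hz.2]⟩
    simp only [Set.mem_iUnion, Metric.mem_closedBall, Real.dist_eq]
    exact ⟨c, hc, by simpa using hzc⟩
  have hvol := (MeasureTheory.measure_mono (μ := MeasureTheory.volume) hsub).trans
    (MeasureTheory.measure_biUnion_finset_le C _)
  simp only [Real.volume_Icc, Real.volume_closedBall, Finset.sum_const, nsmul_eq_mul,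
    add_sub_cancel_left] at hvol
  rw [← ENNReal.ofReal_natCast, ← ENNReal.ofReal_mul (by positivity),
    ENNReal.ofReal_le_ofReal_iff (by positivity)] at hvol
  exact hvol

/-- At suitable scales with ratio `ρ / r = δ`, the covering numbers of the attractor are at least
comparable to `1 / δ`. -/
theorem exists_large_localCoverNumber {F : Set (EuclideanSpace ℝ (Fin 2))}
    (hF : IsAttractor (planarIFS specialT) F) {e : ℕ} (he : 3 ≤ e) :
    ∃ n : ℕ, ∀ N : ℕ, localCoverNumber F ((1 / 5) ^ n) ((1 / 5) ^ n * (5 * (1 / 5) ^ e)) ≤ N →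
      1 / 2 ≤ N * (20 * (1 / 5 : ℝ) ^ e) := by
  obtain ⟨n, b, h⟩ := exists_dense_digitSums e (5 ^ e)
  set δ : ℝ := 5 * (1 / 5) ^ e with hδ
  have hδ0 : 0 < δ := by positivity
  have hδ1 : δ ≤ 1 / 25 := by
    have : (1 / 5 : ℝ) ^ e ≤ (1 / 5) ^ 3 := pow_le_pow_of_le_one (by norm_num) (by norm_num) he
    rw [hδ]
    linarith
  -- Only length 1/2 is used: digit sums approximating `b + y` with y ≤ 1/2 are within 1/2 + 2δ < 1
  -- of `x₀`, so the rescaled points stay in one ball of radius 5^(-n).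
  have hlen : (1 / 2 : ℝ) ≤ δ + (5 ^ e : ℕ) * (4 * (1 / 5) ^ e) := by
    have : (5 : ℝ) ^ e * (1 / 5) ^ e = 1 := by rw [← mul_pow]; norm_num
    push_cast
    nlinarith
  have hn : (0 : ℝ) < (1 / 5) ^ n := by positivity
  refine ⟨n, fun N hN => ?_⟩
  obtain ⟨x₀, hx₀, hbx₀⟩ := h 0 ⟨le_rfl, by linarith⟩
  have hcov := (le_iSup₂_of_le (f := fun x (_ : x ∈ F) =>
    coverNumber (F ∩ Metric.ball x ((1 / 5) ^ n)) ((1 / 5) ^ n * δ)) _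
    (digitSums_mem_attractor hF hx₀) le_rfl).trans hN
  obtain ⟨C, hC, hCN⟩ := exists_finset_of_coverNumber_le hcov
  have hdist : ∀ x y : ℝ, dist (!₂[x * (1 / 5) ^ n, 0] : EuclideanSpace ℝ (Fin 2))
      !₂[y * (1 / 5) ^ n, 0] = (1 / 5) ^ n * |x - y| := fun x y => by
    rw [EuclideanSpace.dist_eq]
    simp only [Fin.sum_univ_two]
    simp [Real.sqrt_sq_eq_abs, Real.dist_eq, ← sub_mul, abs_mul, mul_comm]
  -- One `δ` is the approximation error, the other the rescaled radius of the covering balls.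
  have hle : (1 / 2 : ℝ) ≤ C.card * (2 * (2 * δ)) := by
    refine length_le_card_mul_of_cover (b := b) (f := fun c => 5 ^ n * c 0) (by positivity)
      fun y hy => ?_
    obtain ⟨x, hx, hxy⟩ := h y ⟨hy.1, hy.2.trans hlen⟩
    have hball : !₂[x * (1 / 5) ^ n, 0] ∈ F ∩ Metric.ball !₂[x₀ * (1 / 5) ^ n, 0]
        ((1 / 5) ^ n) := by
      refine ⟨digitSums_mem_attractor hF hx, ?_⟩
      rw [Metric.mem_ball, hdist]
      refine mul_lt_of_lt_one_right hn ?_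
      rw [abs_le] at hxy hbx₀
      rw [abs_lt]
      constructor <;> linarith [hy.1, hy.2]
    obtain ⟨c, hc, hxc⟩ := Set.mem_iUnion₂.1 (hC hball)
    refine ⟨c, hc, ?_⟩
    have h0 := (PiLp.dist_apply_le (p := 2) (!₂[x * (1 / 5) ^ n, 0]) c 0).trans_lt
      (Metric.mem_ball.1 hxc)
    have h5 : (5 : ℝ) ^ n * (1 / 5) ^ n = 1 := by rw [← mul_pow]; norm_num
    have h1 : |x - 5 ^ n * c 0| ≤ δ := by
      have e1 : x - 5 ^ n * c 0 = 5 ^ n * (x * (1 / 5) ^ n - c 0) := by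
        linear_combination -x * h5
      rw [e1, abs_mul, abs_of_pos (by positivity)]
      have h0' : |x * (1 / 5) ^ n - c 0| < (1 / 5) ^ n * δ := by simpa [Real.dist_eq] using h0
      calc (5 : ℝ) ^ n * |x * (1 / 5) ^ n - c 0| ≤ 5 ^ n * ((1 / 5) ^ n * δ) := by gcongr
        _ = δ := by rw [← mul_assoc, h5, one_mul]
    rw [abs_le] at h1 hxy ⊢
    constructor <;> linarith
  have hCN' : (C.card : ℝ) ≤ N := by exact_mod_cast hCN
  calc (1 / 2 : ℝ) ≤ C.card * (2 * (2 * δ)) := hle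
    _ ≤ N * (2 * (2 * δ)) := by gcongr
    _ = N * (20 * (1 / 5 : ℝ) ^ e) := by rw [hδ]; ring

theorem one_le_assouadDim_attractor {F : Set (EuclideanSpace ℝ (Fin 2))}
    (hF : IsAttractor (planarIFS specialT) F) : 1 ≤ assouadDim F := by
  refine le_iInf₂ fun s hs => ?_
  obtain ⟨K, hK⟩ := hs
  by_contra hlt
  have hs1 : (s : ℝ) < 1 := by
    rw [not_le] at hlt
    exact_mod_cast hlt
  -- For s < 1 the right side tends to 0 as `e` grows; its second term pays for rounding the bound
  -- on the covering number up to an integer.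
  have hbound : ∀ e : ℕ, 3 ≤ e →
      1 / 2 ≤ (|K| * (5 ^ (s : ℝ))⁻¹ * 20) * (5 ^ ((s : ℝ) - 1)) ^ e + 20 * (1 / 5 : ℝ) ^ e := by
    intro e he
    obtain ⟨n, hn⟩ := exists_large_localCoverNumber hF he
    have hn0 : (0 : ℝ) < (1 / 5) ^ n := by positivity
    have hδ1 : 5 * (1 / 5 : ℝ) ^ e < 1 := by
      have : (1 / 5 : ℝ) ^ e ≤ (1 / 5) ^ 3 := pow_le_pow_of_le_one (by norm_num) (by norm_num) he
      linarith
    have h := hK ((1 / 5) ^ n) ((1 / 5) ^ n * (5 * (1 / 5) ^ e)) (by positivity)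
      (mul_lt_of_lt_one_right hn0 hδ1) (pow_le_one₀ (by norm_num) (by norm_num))
    have hratio : (1 / 5 : ℝ) ^ n / ((1 / 5) ^ n * (5 * (1 / 5) ^ e)) = 5 ^ e / 5 := by
      rw [one_div, inv_pow, inv_pow]
      field_simp
    rw [hratio] at h
    set M : ℝ := K * (5 ^ e / 5) ^ (s : ℝ) with hM
    have hN : localCoverNumber F ((1 / 5) ^ n) ((1 / 5) ^ n * (5 * (1 / 5) ^ e)) ≤ ⌈M⌉₊ := by
      have : ENNReal.ofReal M ≤ (⌈M⌉₊ : ℝ≥0∞) := by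
        rw [← ENNReal.ofReal_natCast]
        exact ENNReal.ofReal_le_ofReal (Nat.le_ceil M)
      exact_mod_cast h.trans this
    have h1 := hn _ hN
    have hceil : (⌈M⌉₊ : ℝ) ≤ |M| + 1 :=
      (Nat.cast_le.2 (Nat.ceil_mono (le_abs_self M))).trans (Nat.ceil_lt_add_one (abs_nonneg M)).le
    have h2 : (1 / 2 : ℝ) ≤ (|M| + 1) * (20 * (1 / 5 : ℝ) ^ e) := h1.trans (by gcongr)
    refine h2.trans (le_of_eq ?_)
    rw [hM, abs_mul, abs_of_pos (a := (5 ^ e / 5 : ℝ) ^ (s : ℝ)) (by positivity),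
      Real.div_rpow (by positivity) (by positivity), Real.rpow_sub_one (by norm_num),
      ← Real.rpow_pow_comm (by norm_num)]
    simp only [div_pow, one_pow]
    field_simp
  have hr : (5 : ℝ) ^ ((s : ℝ) - 1) < 1 :=
    Real.rpow_lt_one_of_one_lt_of_neg (by norm_num) (by linarith)
  have hlim : Filter.Tendsto (fun e : ℕ => (|K| * (5 ^ (s : ℝ))⁻¹ * 20) *
      ((5 : ℝ) ^ ((s : ℝ) - 1)) ^ e + 20 * (1 / 5 : ℝ) ^ e) Filter.atTop (nhds 0) := by
    simpa using ((tendsto_pow_atTop_nhds_zero_of_lt_one (by positivity) hr).const_mul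
      (|K| * (5 ^ (s : ℝ))⁻¹ * 20)).add ((tendsto_pow_atTop_nhds_zero_of_lt_one (r := (1 / 5 : ℝ))
        (by norm_num) (by norm_num)).const_mul 20)
  have := ge_of_tendsto hlim (Filter.eventually_atTop.2 ⟨3, hbound⟩)
  norm_num at this

/-! ### Natural covers and the Hausdorff dimension -/

/-- A bounded set that is contained in the union of its images under `N` contractions of ratio `c`
is covered by `N ^ k` balls of radius `c ^ k * D`. -/
theorem exists_finset_cover_of_subset_images {X ι : Type*} [PseudoMetricSpace X] [Fintype ι]
    {S : ι → X → X} {c : ℝ} (hc0 : 0 ≤ c)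
    (hS : ∀ i x y, dist (S i x) (S i y) ≤ c * dist x y) {F : Set X}
    (hF : ∀ p ∈ F, ∃ i, ∃ q ∈ F, S i q = p) {q₀ : X} {D : ℝ} (hD : ∀ p ∈ F, dist p q₀ ≤ D) (k : ℕ) :
    ∃ P : Finset X, P.card ≤ Fintype.card ι ^ k ∧ ∀ p ∈ F, ∃ q ∈ P, dist p q ≤ c ^ k * D := by
  classical
  induction k with
  | zero => exact ⟨{q₀}, by simp, by simpa using hD⟩
  | succ k ih =>
    obtain ⟨P, hP, hcov⟩ := ih
    refine ⟨(Finset.univ ×ˢ P).image fun a => S a.1 a.2, ?_, fun p hp => ?_⟩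
    · refine Finset.card_image_le.trans ?_
      rw [Finset.card_product, Finset.card_univ, pow_succ']
      gcongr
    · obtain ⟨i, p', hp', rfl⟩ := hF p hp
      obtain ⟨q, hq, hpq⟩ := hcov p' hp'
      refine ⟨S i q, Finset.mem_image.2 ⟨(i, q), by simp [hq], rfl⟩, (hS i p' q).trans ?_⟩
      calc c * dist p' q ≤ c * (c ^ k * D) := by gcongr
        _ = c ^ (k + 1) * D := by ring

/-- With 5^s = 4, the 4^k balls of radius 5^(-k) D have s-sum at most (2D)^s for every k, so the
s-dimensional measure is finite. -/
theorem dimH_attractor_le {t : ℝ} {F : Set (EuclideanSpace ℝ (Fin 2))}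
    (hF : IsAttractor (planarIFS t) F) :
    dimH F ≤ ENNReal.ofReal (Real.log 4 / Real.log 5) := by
  obtain ⟨D, hD⟩ := hF.2.1.isBounded.subset_closedBall 0
  have hD0 : 0 ≤ D := dist_nonneg.trans (hD (zero_mem_attractor hF))
  choose P hP hcov using exists_finset_cover_of_subset_images (c := 1 / 5) (by norm_num)
    (fun i x y => (dist_planarIFS t i x y).le) (fun p hp => attractor_exists_preimage hF hp)
    (q₀ := 0) (D := D) hD
  have hs0 : 0 ≤ Real.log 4 / Real.log 5 :=
    div_nonneg (Real.log_nonneg (by norm_num)) (Real.log_nonneg (by norm_num))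
  set s : ℝ := Real.log 4 / Real.log 5 with hs
  have h5s : (5 : ℝ) ^ s = 4 := by
    rw [hs, Real.log_div_log, Real.rpow_logb (by norm_num) (by norm_num) (by norm_num)]
  rw [ENNReal.ofReal]
  refine dimH_le_of_hausdorffMeasure_ne_top ?_
  rw [Real.coe_toNNReal s hs0]
  let r : ℕ → ℝ := fun k => 2 * ((1 / 5) ^ k * D)
  have hr0 : ∀ k, 0 ≤ r k := fun k => by positivity
  have hr : Filter.Tendsto (fun k => ENNReal.ofReal (r k)) Filter.atTop (nhds 0) := by
    have : Filter.Tendsto r Filter.atTop (nhds 0) := by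
      simpa [r] using ((tendsto_pow_atTop_nhds_zero_of_lt_one (r := (1 / 5 : ℝ)) (by norm_num)
        (by norm_num)).mul_const D).const_mul 2
    simpa using ENNReal.tendsto_ofReal this
  have hdiam : ∀ k (q : P k),
      Metric.ediam (Metric.closedBall (q : EuclideanSpace ℝ (Fin 2)) ((1 / 5) ^ k * D)) ≤
        ENNReal.ofReal (r k) := fun k q => by
    refine Metric.ediam_le_of_forall_dist_le fun x hx y hy => ?_
    have := dist_triangle_right x y (q : EuclideanSpace ℝ (Fin 2))
    have h1 := Metric.mem_closedBall.1 hx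
    have h2 := Metric.mem_closedBall.1 hy
    simp only [r]
    linarith
  have hle := MeasureTheory.Measure.hausdorffMeasure_le_liminf_sum s F
    (fun k => ENNReal.ofReal (r k)) hr
    (fun k (q : P k) => Metric.closedBall (q : EuclideanSpace ℝ (Fin 2)) ((1 / 5) ^ k * D))
    (Filter.Eventually.of_forall hdiam) (Filter.Eventually.of_forall fun k p hp => by
      obtain ⟨q, hq, hpq⟩ := hcov k p hp
      exact Set.mem_iUnion.2 ⟨⟨q, hq⟩, hpq⟩)
  refine ne_top_of_le_ne_top (b := ENNReal.ofReal ((2 * D) ^ s)) ENNReal.ofReal_ne_top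
    (hle.trans ?_)
  refine Filter.liminf_le_of_frequently_le' (Filter.Frequently.of_forall fun k => ?_)
  calc ∑ q : P k, Metric.ediam
        (Metric.closedBall (q : EuclideanSpace ℝ (Fin 2)) ((1 / 5) ^ k * D)) ^ s
      ≤ ∑ q : P k, ENNReal.ofReal (r k) ^ s :=
        Finset.sum_le_sum fun q _ => ENNReal.rpow_le_rpow (hdiam k q) hs0
    _ = (P k).card * ENNReal.ofReal (r k ^ s) := by
        rw [Finset.sum_const, nsmul_eq_mul, ENNReal.ofReal_rpow_of_nonneg (hr0 k) hs0]
        simp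
    _ ≤ (4 ^ k : ℕ) * ENNReal.ofReal (r k ^ s) := by
        gcongr
        exact_mod_cast hP k
    _ = ENNReal.ofReal ((2 * D) ^ s) := by
        rw [← ENNReal.ofReal_natCast, ← ENNReal.ofReal_mul (by positivity)]
        congr 1
        have e : r k = (1 / 5) ^ k * (2 * D) := by simp only [r]; ring
        rw [e, Real.mul_rpow (by positivity) (by positivity), ← Real.rpow_pow_comm (by norm_num),
          Real.div_rpow (by norm_num) (by norm_num), h5s, Real.one_rpow, ← mul_assoc]
        push_cast
        rw [← mul_pow]
        norm_num

/-! ### Upper bound for the Assouad dimension -/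

/-- Points of a `5`-adic Cantor set that are closer than `5 ^ (-n)` share their first `n`
digits. -/
theorem exists_common_prefix {Y : Set ℝ} (hY : Y ⊆ Set.Icc 0 1)
    (hstep : ∀ y ∈ Y, ∃ z ∈ Y, ∃ a : ℝ, (a = 0 ∨ a = 4 / 5) ∧ y = z / 5 + a) (n : ℕ) {y₀ : ℝ}
    (hy₀ : y₀ ∈ Y) :
    ∃ g : ℝ, ∀ y ∈ Y, |y - y₀| < (1 / 5) ^ n → ∃ z ∈ Y, y = g + (1 / 5) ^ n * z := by
  induction n generalizing y₀ with
  | zero => exact ⟨0, fun y hy _ => ⟨y, hy, by simp⟩⟩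
  | succ n ih =>
    obtain ⟨z₀, hz₀, a₀, ha₀, rfl⟩ := hstep y₀ hy₀
    obtain ⟨g, hg⟩ := ih hz₀
    refine ⟨g / 5 + a₀, fun y hy hlt => ?_⟩
    obtain ⟨z, hz, a, ha, rfl⟩ := hstep y hy
    have hn1 : (1 / 5 : ℝ) ^ n ≤ 1 := pow_le_one₀ (by norm_num) (by norm_num)
    rw [pow_succ, abs_lt] at hlt
    have hz1 := hY hz
    have hz2 := hY hz₀
    -- Different first digits would put the points at distance at least 4/5 - 1/5 = 3/5, more than
    -- 1/5.
    have haa : a = a₀ := by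
      rcases ha with rfl | rfl <;> rcases ha₀ with rfl | rfl <;>
        first
        | rfl
        | linarith [hz1.1, hz1.2, hz2.1, hz2.2, hlt.1, hlt.2]
    subst haa
    obtain ⟨w, hw, rfl⟩ := hg z hz (by rw [abs_lt]; constructor <;> linarith)
    exact ⟨w, hw, by rw [pow_succ]; ring⟩

/-- Covers of the part of a `5`-adic Cantor set near one of its points. -/
theorem exists_local_cantor_cover {Y : Set ℝ} (hY : Y ⊆ Set.Icc 0 1)
    (hstep : ∀ y ∈ Y, ∃ z ∈ Y, ∃ a : ℝ, (a = 0 ∨ a = 4 / 5) ∧ y = z / 5 + a) (n k : ℕ) {y₀ : ℝ}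
    (hy₀ : y₀ ∈ Y) :
    ∃ G : Finset ℝ, G.card ≤ 2 ^ k ∧
      ∀ y ∈ Y, |y - y₀| < (1 / 5) ^ n → ∃ g ∈ G, |y - g| ≤ (1 / 5) ^ (n + k) := by
  obtain ⟨g, hg⟩ := exists_common_prefix hY hstep n hy₀
  obtain ⟨P, hP, hcov⟩ := exists_finset_cover_of_subset_images (ι := Fin 2) (F := Y)
    (S := fun i y => y / 5 + (![0, 4 / 5] : Fin 2 → ℝ) i) (c := 1 / 5) (q₀ := 0) (D := 1)
    (by norm_num) (fun i x y => by
      rw [dist_add_right, Real.dist_eq, Real.dist_eq, ← sub_div, abs_div, abs_of_pos (a := (5 : ℝ))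
        (by norm_num)]
      linarith) (fun y hy => by
      obtain ⟨z, hz, a, ha, rfl⟩ := hstep y hy
      rcases ha with rfl | rfl
      · exact ⟨0, z, hz, by simp⟩
      · exact ⟨1, z, hz, by simp⟩) (fun y hy => by
      rw [Real.dist_eq, sub_zero, abs_of_nonneg (hY hy).1]
      exact (hY hy).2) k
  refine ⟨P.image fun q => g + (1 / 5) ^ n * q, Finset.card_image_le.trans (by simpa using hP),
    fun y hy hlt => ?_⟩
  obtain ⟨z, hz, rfl⟩ := hg y hy hlt
  obtain ⟨q, hq, hzq⟩ := hcov z hz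
  refine ⟨_, Finset.mem_image_of_mem _ hq, ?_⟩
  rw [Real.dist_eq, mul_one] at hzq
  rw [add_sub_add_left_eq_sub, ← mul_sub, abs_mul, abs_of_pos (by positivity), pow_add]
  gcongr

theorem exists_interval_cover (x₀ : ℝ) {r h : ℝ} (hr : 0 ≤ r) (hh : 0 < h) :
    ∃ P : Finset ℝ, (P.card : ℝ) ≤ 2 * r / h + 1 ∧
      ∀ x : ℝ, |x - x₀| ≤ r → ∃ q ∈ P, |x - q| ≤ h := by
  classical
  refine ⟨(Finset.range (⌊2 * r / h⌋₊ + 1)).image fun i : ℕ => x₀ - r + i * h, ?_, fun x hx => ?_⟩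
  · refine (Nat.cast_le.2 Finset.card_image_le).trans ?_
    rw [Finset.card_range]
    push_cast
    gcongr
    exact Nat.floor_le (by positivity)
  · rw [abs_le] at hx
    have h0 : 0 ≤ (x - (x₀ - r)) / h := div_nonneg (by linarith) hh.le
    refine ⟨_, Finset.mem_image_of_mem _ (a := ⌊(x - (x₀ - r)) / h⌋₊) ?_, ?_⟩
    · rw [Finset.mem_range, Nat.lt_succ_iff]
      apply Nat.floor_mono
      gcongr
      linarith
    · have h1 := Nat.floor_le h0
      have h2 := (Nat.lt_floor_add_one ((x - (x₀ - r)) / h)).le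
      rw [le_div_iff₀ hh] at h1
      rw [div_le_iff₀ hh] at h2
      rw [abs_le]
      constructor <;> linarith

theorem dist_le_abs_add_abs (p q : EuclideanSpace ℝ (Fin 2)) :
    dist p q ≤ |p 0 - q 0| + |p 1 - q 1| := by
  rw [EuclideanSpace.dist_eq, Fin.sum_univ_two, Real.dist_eq, Real.dist_eq]
  refine Real.sqrt_le_iff.2 ⟨by positivity, ?_⟩
  nlinarith [mul_nonneg (abs_nonneg (p 0 - q 0)) (abs_nonneg (p 1 - q 1))]

theorem coverNumber_le_card_mul_card {E : Set (EuclideanSpace ℝ (Fin 2))} {ρ δ : ℝ} (hδ : 2 * δ < ρ)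
    {P G : Finset ℝ} (hP : ∀ p ∈ E, ∃ q ∈ P, |p 0 - q| ≤ δ) (hG : ∀ p ∈ E, ∃ g ∈ G, |p 1 - g| ≤ δ) :
    coverNumber E ρ ≤ (P.card * G.card : ℕ) := by
  classical
  refine (iInf₂_le ((P ×ˢ G).image fun a => (!₂[a.1, a.2] : EuclideanSpace ℝ (Fin 2)))
    fun p hp => ?_).trans ?_
  · obtain ⟨q, hq, hpq⟩ := hP p hp
    obtain ⟨g, hg, hpg⟩ := hG p hp
    refine Set.mem_iUnion₂.2 ⟨!₂[q, g],
      Finset.mem_image.2 ⟨(q, g), Finset.mem_product.2 ⟨hq, hg⟩, rfl⟩, ?_⟩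
    rw [Metric.mem_ball]
    refine (dist_le_abs_add_abs _ _).trans_lt ?_
    simp only [Matrix.cons_val_zero, Matrix.cons_val_one]
    linarith
  · rw [← Finset.card_product]
    exact_mod_cast Finset.card_image_le

/-- A ball of radius r is covered by a grid: about r/ρ intervals horizontally times 2^k Cantor
pieces vertically, where 5^k is comparable to r/ρ. -/
theorem assouadDim_attractor_le {t : ℝ} {F : Set (EuclideanSpace ℝ (Fin 2))}
    (hF : IsAttractor (planarIFS t) F) :
    assouadDim F ≤ 1 + ENNReal.ofReal (Real.log 2 / Real.log 5) := by
  have hσ0 : 0 ≤ Real.log 2 / Real.log 5 :=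
    div_nonneg (Real.log_nonneg (by norm_num)) (Real.log_nonneg (by norm_num))
  set σ : ℝ := Real.log 2 / Real.log 5 with hσ
  have h5σ : (5 : ℝ) ^ σ = 2 := by
    rw [hσ, Real.log_div_log, Real.rpow_logb (by norm_num) (by norm_num) (by norm_num)]
  refine (iInf₂_le (1 + σ.toNNReal) ⟨9 * 100 ^ σ, fun r ρ hρ hρr hr1 => ?_⟩).trans (le_of_eq ?_)
  · rw [ENNReal.coe_add, ENNReal.coe_one, ENNReal.ofReal]
  rw [NNReal.coe_add, NNReal.coe_one, Real.coe_toNNReal σ hσ0]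
  have hr0 : 0 < r := hρ.trans hρr
  obtain ⟨n, hn1, hn2⟩ := exists_nat_pow_near_of_lt_one hr0 hr1 (y := (1 / 5 : ℝ)) (by norm_num)
    (by norm_num)
  obtain ⟨m, hm1, hm2⟩ := exists_nat_pow_near_of_lt_one (x := ρ / 4) (by linarith) (by linarith)
    (y := (1 / 5 : ℝ)) (by norm_num) (by norm_num)
  obtain ⟨k, hk⟩ : ∃ k, m + 1 = n + k := Nat.exists_eq_add_of_le (by
    by_contra! hle
    have := pow_le_pow_of_le_one (a := (1 / 5 : ℝ)) (by norm_num) (by norm_num) hle.le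
    linarith)
  -- Here 5^(-n) < 5r and 5^(m+1) ≤ 20/ρ, whence the factor 100.
  have h5k : (5 : ℝ) ^ k ≤ 100 * (r / ρ) := by
    have e1 : (1 / 5 : ℝ) ^ n = 5 ^ k * ((1 / 5) ^ m * (1 / 5)) := by
      rw [← pow_succ, hk, pow_add, mul_left_comm, ← mul_pow]
      norm_num
    rw [pow_succ, e1] at hn1
    rw [← mul_div_assoc, le_div_iff₀ hρ]
    have : (5 : ℝ) ^ k * (ρ / 4) ≤ 5 ^ k * (1 / 5) ^ m := by gcongr
    linarith
  have h2k : (2 : ℝ) ^ k ≤ 100 ^ σ * (r / ρ) ^ σ := by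
    rw [← Real.mul_rpow (by norm_num) (by positivity), ← h5σ, Real.rpow_pow_comm (by norm_num)]
    exact Real.rpow_le_rpow (by positivity) h5k hσ0
  have hcov : ∀ x ∈ F, coverNumber (F ∩ Metric.ball x r) ρ ≤
      (⌊9 * 100 ^ σ * (r / ρ) ^ (1 + σ)⌋₊ : ℕ) := fun x hx => by
    obtain ⟨P, hPc, hP⟩ := exists_interval_cover (x 0) hr0.le (h := ρ / 4) (by linarith)
    obtain ⟨G, hGc, hG⟩ := exists_local_cantor_cover (Y := (fun p => p 1) '' F)
      (by rintro _ ⟨p, hp, rfl⟩; exact attractor_coord_one_mem_Icc hF hp)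
      (by
        rintro _ ⟨p, hp, rfl⟩
        obtain ⟨q, hq, a, ha, e⟩ := attractor_coord_one_step hF hp
        exact ⟨_, ⟨q, hq, rfl⟩, a, ha, e⟩) n k ⟨x, hx, rfl⟩
    have hcoord : ∀ p ∈ Metric.ball x r, ∀ i, |p i - x i| < r := fun p hp i => by
      rw [← Real.dist_eq]
      exact (PiLp.dist_apply_le p x i).trans_lt hp
    refine (coverNumber_le_card_mul_card (P := P) (G := G) (δ := ρ / 4) (by linarith)
      (fun p hp => hP _ (hcoord p hp.2 0).le) fun p hp => ?_).trans ?_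
    · obtain ⟨g, hg, hpg⟩ := hG _ ⟨p, hp.1, rfl⟩ ((hcoord p hp.2 1).trans_le hn2)
      exact ⟨g, hg, hpg.trans (hk ▸ hm1.le)⟩
    · refine Nat.cast_le.2 (Nat.le_floor ?_)
      have hrρ : 1 ≤ r / ρ := (one_le_div hρ).2 hρr.le
      have hPc' : (P.card : ℝ) ≤ 9 * (r / ρ) := hPc.trans (by
        have : 2 * r / (ρ / 4) = 8 * (r / ρ) := by field_simp; norm_num
        linarith)
      have hGc' : (G.card : ℝ) ≤ 100 ^ σ * (r / ρ) ^ σ :=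
        (by exact_mod_cast hGc : (G.card : ℝ) ≤ 2 ^ k).trans h2k
      push_cast
      calc (P.card : ℝ) * G.card ≤ 9 * (r / ρ) * (100 ^ σ * (r / ρ) ^ σ) := by gcongr
        _ = 9 * 100 ^ σ * (r / ρ) ^ (1 + σ) := by
          rw [Real.rpow_add (by positivity), Real.rpow_one]
          ring
  have hloc : localCoverNumber F r ρ ≤ (⌊9 * 100 ^ σ * (r / ρ) ^ (1 + σ)⌋₊ : ℕ) :=
    iSup₂_le hcov
  have hloc' : (localCoverNumber F r ρ : ℝ≥0∞) ≤
      ((⌊9 * 100 ^ σ * (r / ρ) ^ (1 + σ)⌋₊ : ℕ) : ℝ≥0∞) := by exact_mod_cast hloc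
  refine hloc'.trans ?_
  rw [← ENNReal.ofReal_natCast]
  exact ENNReal.ofReal_le_ofReal (Nat.floor_le (by positivity))

/-! ### Failure of the dichotomy -/

theorem log_four_div_log_five_lt_one : ENNReal.ofReal (Real.log 4 / Real.log 5) < 1 := by
  rw [ENNReal.ofReal_lt_one, div_lt_one (Real.log_pos (by norm_num))]
  exact Real.log_lt_log (by norm_num) (by norm_num)

theorem one_add_log_two_div_log_five_lt_two :
    1 + ENNReal.ofReal (Real.log 2 / Real.log 5) < 2 := by
  refine (ENNReal.add_lt_add_left ENNReal.one_ne_top ?_).trans_eq one_add_one_eq_two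
  rw [ENNReal.ofReal_lt_one, div_lt_one (Real.log_pos (by norm_num))]
  exact Real.log_lt_log (by norm_num) (by norm_num)

theorem mainTheorem7 :
    (∃! F : Set (EuclideanSpace ℝ (Fin 2)), IsAttractor (planarIFS specialT) F) ∧
    (∀ F : Set (EuclideanSpace ℝ (Fin 2)), IsAttractor (planarIFS specialT) F →
      ¬ InHyperplane F ∧
      dimH F ≤ ENNReal.ofReal (Real.log 4 / Real.log 5) ∧
      ENNReal.ofReal (Real.log 4 / Real.log 5) < 1 ∧
      1 ≤ assouadDim F ∧
      assouadDim F ≤ 1 + ENNReal.ofReal (Real.log 2 / Real.log 5) ∧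
      1 + ENNReal.ofReal (Real.log 2 / Real.log 5) < 2) ∧
    ¬ EqualityMaximalDichotomy 2 := by
  refine ⟨existsUnique_attractor_planarIFS specialT, fun F hF => ⟨not_inHyperplane_attractor hF,
    dimH_attractor_le hF, log_four_div_log_five_lt_one, one_le_assouadDim_attractor hF,
    assouadDim_attractor_le hF, one_add_log_two_div_log_five_lt_two⟩, fun h => ?_⟩
  obtain ⟨F, hF, -⟩ := existsUnique_attractor_planarIFS specialT
  rcases h F (isSelfSimilarSet_attractor_planarIFS hF) (not_inHyperplane_attractor hF) with e | e
  · have h1 := one_le_assouadDim_attractor hF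
    rw [e] at h1
    exact (h1.trans (dimH_attractor_le hF)).not_gt log_four_div_log_five_lt_one
  · have h2 := (assouadDim_attractor_le hF).trans_lt one_add_log_two_div_log_five_lt_two
    rw [e] at h2
    exact h2.ne (by norm_num)
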